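/- Theorem (butterfly network routing). Let $n=2^L$ with $L\ge 1$, so that $L=\log_2 n$. The $n$-input butterfly network has the $n\log_2 n$ nodes $(w,i)$ with $w\in\{0,1\}^L$ and $i\in\mathbb{Z}/L$ and $2n\log_2 n$ directed edges: from each node $(w,i)$ a straight edge to $(w,i+1)$ and a cross edge to $(w^{(i)},i+1)$, where $w^{(i)}$ is $w$ with its $i$-th bit flipped. (The output column is identified with the input column.) The $n$ nodes $(w,0)$ are the input/output nodes. An instance consists of $n\log_2 n$ source-sink pairs $(s_j,t_j)$ of input/output nodes such that every input/output node is the source of exactly $\log_2 n$ of the pairs and the sink of exactly $\log_2 n$ of them. A pair $(s,t)$ is routed in two phases: by a directed walk of $\log_2 n$ edges from $s$ to some intermediate input/output node $r$, followed by a directed walk of $\log_2 n$ edges from $r$ to $t$. The congestion of an edge is the number of times that it is used by the chosen routes, over both phases. There are absolute constants $c,C,D>0$ and $N$ such that for every $n=2^L\ge N$ and every such instance: (1) there are at least $cn$ of the pairs that can be routed simultaneously so that every edge has congestion at most $C\,\dfrac{\log\log n}{\log\log\log n}$; (2) whenever a set of pairs is routed with congestion at most $C\,\dfrac{\log\log n}{\log\log\log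 n}$ on every edge, no node is the source or sink of more than $D\log\log n$ of the routed pairs. -/

import Mathlib

namespace ButterflyRouting

/-- The `n = 2 ^ L` rows of the butterfly: binary words of length `L = log n`. -/
abbrev Row (L : ℕ) := Fin L → Bool

/-- The nodes of the `n`-input butterfly: `L = log n` levels with `n` nodes each. The output
column is identified with the input column, so that a message can pass through the network
repeatedly; level `0` consists of the `n` input/output nodes. -/
abbrev Node (L : ℕ) := Row L × Fin L

/-- Every node has two outgoing (directed) edges. The edge `(v, false)` is the straight edge and
`(v, true)` the cross edge out of `v`. -/
abbrev Edge (L : ℕ) := Node L × Bool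

/-- The node at which an edge starts. -/
def Edge.tail {L : ℕ} (e : Edge L) : Node L := e.1

/-- The node at which an edge ends: an edge from level `i` leads to level `i + 1` (modulo `L`); a
straight edge stays in its row, a cross edge flips the `i`-th bit of the row. -/
def Edge.head {L : ℕ} [NeZero L] (e : Edge L) : Node L :=
  (if e.2 then Function.update e.1.1 e.1.2 (!(e.1.1 e.1.2)) else e.1.1, e.1.2 + 1)

/-- The input/output node of row `w`. -/
def terminal {L : ℕ} [NeZero L] (w : Row L) : Node L := (w, 0)

/-- The butterfly has `n log n` nodes. -/
theorem card_node (L : ℕ) : Fintype.card (Node L) = 2 ^ L * L := by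
  simp

/-- The butterfly has `2 n log n` edges. -/
theorem card_edge (L : ℕ) : Fintype.card (Edge L) = 2 * (2 ^ L * L) := by
  simp [mul_comm]

/-- `IsWalk u p v`: the list of edges `p` is a directed walk from `u` to `v`. -/
def IsWalk {L : ℕ} [NeZero L] : Node L → List (Edge L) → Node L → Prop
  | u, [], v => u = v
  | u, e :: p, v => Edge.tail e = u ∧ IsWalk (Edge.head e) p v

/-- A two-phase route from the input/output node of row `s` to that of row `t`: a pass through the
network (`log n` edges) from `s` to an intermediate destination, followed by a pass from there
to `t`. -/
structure Route {L : ℕ} [NeZero L] (s t : Row L) where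
  mid : Row L
  phase₁ : List (Edge L)
  phase₂ : List (Edge L)
  length₁ : phase₁.length = L
  length₂ : phase₂.length = L
  walk₁ : IsWalk (terminal s) phase₁ (terminal mid)
  walk₂ : IsWalk (terminal mid) phase₂ (terminal t)

/-- The edges of a route, in order and with multiplicity. -/
def Route.edges {L : ℕ} [NeZero L] {s t : Row L} (P : Route s t) : List (Edge L) :=
  P.phase₁ ++ P.phase₂

/-- A routing instance: `n log n` source-destination pairs such that each input/output node is the
source of `log n` of them and the destination of `log n` of them. -/
structure Instance (L : ℕ) where
  src : Fin (2 ^ L * L) → Row L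
  dst : Fin (2 ^ L * L) → Row L
  card_src : ∀ w : Row L, (Finset.univ.filter fun i => src i = w).card = L
  card_dst : ∀ w : Row L, (Finset.univ.filter fun i => dst i = w).card = L

/-- A routing of the set `S` of pairs of an instance: a route for each pair in `S`. -/
abbrev Routing {L : ℕ} [NeZero L] (I : Instance L) (S : Finset (Fin (2 ^ L * L))) :=
  ∀ i : S, Route (I.src i) (I.dst i)

/-- The congestion of an edge: how often it is used by the routes of the routed pairs (an edge used
in both phases of a route counts twice). -/
def Routing.congestion {L : ℕ} [NeZero L] {I : Instance L} {S : Finset (Fin (2 ^ L * L))}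
    (P : Routing I S) (e : Edge L) : ℕ :=
  ∑ i : S, (P i).edges.count e

end ButterflyRouting

/-! For (1), greedily keep n/2 pairs with distinct sources and distinct sinks
(`Instance.exists_injOn`) and route each by bit fixing through a uniformly random middle row. In
each phase every edge then has expected load at most 1 (`card_passEdge_eq_le`). Exponential moments
bound the expected number of pairs that meet an edge of load above K, and those pairs are discarded
(`exists_choice_card_overloaded_le`). With x = log log n and K = 4x / log x, at most n/4 pairs are
lost. For (2), a terminal has two outgoing and two incoming edges, so the congestion bound limits
the routes starting or ending there. -/

namespace ButterflyRouting

open Finset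

/-! ### Random choices and overloaded resources -/

section Choice

variable {α β ι : Type*} [Fintype α] [Fintype β] [Fintype ι] [DecidableEq α]

open Classical in
/-- The exponential moment of the load of a resource under a uniformly random choice function. -/
theorem sum_pow_load_le (R : α → β → Prop) (z : ℝ) (hz : 1 ≤ z)
    (h : #{p : α × β | R p.1 p.2} ≤ Fintype.card β) :
    ∑ r : α → β, z ^ #{a | R a (r a)} ≤ Fintype.card (α → β) * Real.exp z := by
  have hprod : ∀ r : α → β, z ^ #{a | R a (r a)} = ∏ a, if R a (r a) then z else 1 := by
    intro r
    rw [Finset.prod_ite]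
    simp
  simp_rw [hprod]
  -- Independence: the sum over all choice functions factors over `α`.
  have hswap := Finset.prod_univ_sum (fun _ : α => (univ : Finset β))
    (fun a b => if R a b then z else (1 : ℝ))
  rw [Fintype.piFinset_univ] at hswap
  rw [← hswap]
  rcases isEmpty_or_nonempty β with hβ | hβ
  · rcases isEmpty_or_nonempty α with hα | hα
    · simp; linarith
    · simp
  have hB : (0 : ℝ) < Fintype.card β := by exact_mod_cast Fintype.card_pos
  have hrow : ∀ a, (∑ b : β, if R a b then z else (1 : ℝ)) ≤
      Fintype.card β * Real.exp (#{b | R a b} / Fintype.card β * z) := by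
    intro a
    have h1 : (∑ b : β, if R a b then z else (1 : ℝ)) =
        Fintype.card β + #{b | R a b} * (z - 1) := by
      have : ∀ b, (if R a b then z else (1 : ℝ)) = 1 + if R a b then z - 1 else 0 := by
        intro b; split_ifs <;> ring
      simp_rw [this, Finset.sum_add_distrib, ← Finset.sum_filter]
      simp only [Finset.sum_const, Finset.card_univ, nsmul_eq_mul, mul_one]
    have h2 := Real.add_one_le_exp ((#{b | R a b} : ℝ) / Fintype.card β * z)
    rw [h1]
    calc _ ≤ (Fintype.card β : ℝ) * (#{b | R a b} / Fintype.card β * z + 1) := by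
          have : (Fintype.card β : ℝ) * (#{b | R a b} / Fintype.card β * z + 1) =
            #{b | R a b} * z + Fintype.card β := by field_simp
          rw [this]
          have : (0 : ℝ) ≤ #{b | R a b} := by positivity
          linarith
      _ ≤ _ := by gcongr
  calc _ ≤ ∏ a : α, (Fintype.card β * Real.exp (#{b | R a b} / Fintype.card β * z)) := by
        apply Finset.prod_le_prod
        · intro a _
          exact Finset.sum_nonneg fun b _ => by split_ifs <;> linarith
        · exact fun a _ => hrow a
    _ = Fintype.card (α → β) * Real.exp ((∑ a, (#{b | R a b} : ℝ)) / Fintype.card β * z) := by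
        rw [Finset.prod_mul_distrib, ← Real.exp_sum, ← Finset.sum_mul, ← Finset.sum_div]
        simp
    _ ≤ _ := by
        have hsum : ∑ a, #{b | R a b} = #{p : α × β | R p.1 p.2} := by
          simp_rw [Finset.card_filter, Fintype.sum_prod_type]
        have : (∑ a, (#{b | R a b} : ℝ)) / Fintype.card β ≤ 1 := by
          rw [div_le_one hB]
          exact_mod_cast hsum.trans_le h
        gcongr
        nlinarith

open Classical in
/-- If every resource has expected load at most one under a uniformly random choice, then some
choice function has few elements that use a resource of load more than `K`. -/
theorem exists_choice_card_overloaded_le [Nonempty β] (R : ι → α → β → Prop) (y K : ℝ)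
    (hy : 1 ≤ y) (h : ∀ e, #{p : α × β | R e p.1 p.2} ≤ Fintype.card β) :
    ∃ r : α → β, (#{a | ∃ e, R e a (r a) ∧ K < #{a' | R e a' (r a')}} : ℝ) ≤
      Fintype.card ι * Real.exp (2 * y) / y ^ K := by
  have hyK : 0 < y ^ K := Real.rpow_pos_of_pos (by linarith) K
  have hbad : ∀ r : α → β,
      (#{a | ∃ e, R e a (r a) ∧ K < #{a' | R e a' (r a')}} : ℝ) ≤
        ∑ e, (2 * y) ^ #{a' | R e a' (r a')} / y ^ K := by
    intro r
    have h1 : ({a | ∃ e, R e a (r a) ∧ K < #{a' | R e a' (r a')}} : Finset α) ⊆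
        ({e | K < #{a' | R e a' (r a')}} : Finset ι).biUnion
          fun e => ({a' | R e a' (r a')} : Finset α) := by
      intro a ha
      obtain ⟨e, he, hK⟩ := (Finset.mem_filter.1 ha).2
      exact Finset.mem_biUnion.2 ⟨e, by simp [hK], by simp [he]⟩
    have h2 := (Finset.card_le_card h1).trans Finset.card_biUnion_le
    calc _ ≤ ∑ e ∈ ({e | K < #{a' | R e a' (r a')}} : Finset ι),
          (#{a' | R e a' (r a')} : ℝ) := by exact_mod_cast h2
      _ ≤ ∑ e ∈ ({e | K < #{a' | R e a' (r a')}} : Finset ι),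
          (2 * y) ^ #{a' | R e a' (r a')} / y ^ K := by
          apply Finset.sum_le_sum
          intro e he
          have he' := (Finset.mem_filter.1 he).2
          rw [le_div_iff₀ hyK, mul_pow]
          -- A load k > K satisfies k ≤ 2 ^ k and y ^ K ≤ y ^ k, hence k ≤ (2y) ^ k / y ^ K; this is
          -- why the moment is taken at 2y.
          have h3 : y ^ K ≤ y ^ #{a' | R e a' (r a')} := by
            rw [← Real.rpow_natCast]
            exact Real.rpow_le_rpow_of_exponent_le hy he'.le
          have h4 : (#{a' | R e a' (r a')} : ℝ) ≤ 2 ^ #{a' | R e a' (r a')} := by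
            exact_mod_cast Nat.lt_two_pow_self.le
          gcongr
      _ ≤ _ := Finset.sum_le_sum_of_subset_of_nonneg (Finset.subset_univ _)
          fun e _ _ => by positivity
  have hne : (univ : Finset (α → β)).Nonempty := Finset.univ_nonempty
  obtain ⟨r, -, hr⟩ := Finset.exists_le_of_sum_le hne
    (f := fun r : α → β => (#{a | ∃ e, R e a (r a) ∧ K < #{a' | R e a' (r a')}} : ℝ))
    (g := fun _ => Fintype.card ι * Real.exp (2 * y) / y ^ K) (by
      calc _ ≤ ∑ r : α → β, ∑ e, (2 * y) ^ #{a' | R e a' (r a')} / y ^ K :=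
            Finset.sum_le_sum fun r _ => hbad r
        _ = ∑ e, (∑ r : α → β, (2 * y) ^ #{a' | R e a' (r a')}) / y ^ K := by
            rw [Finset.sum_comm]
            simp_rw [Finset.sum_div]
        _ ≤ ∑ e : ι, Fintype.card (α → β) * Real.exp (2 * y) / y ^ K := by
            gcongr with e _
            exact sum_pow_load_le (R e) (2 * y) (by linarith) (h e)
        _ = _ := by
            simp only [Finset.sum_const, Finset.card_univ, nsmul_eq_mul]
            ring)
  exact ⟨r, hr⟩

end Choice

/-! ### Bit-fixing passes -/

section Pass

variable {L : ℕ}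

/-- The row reached by the bit-fixing pass from `s` to `t` after `k` steps. -/
def passRow (s t : Row L) (k : ℕ) : Row L := fun j => if (j : ℕ) < k then t j else s j

/-- The edge used at level `i` by the bit-fixing pass from `s` to `t`. -/
def passEdge (s t : Row L) (i : Fin L) : Edge L := ((passRow s t i, i), s i != t i)

/-- The bit-fixing pass from `s` to `t`. -/
def pass (s t : Row L) : List (Edge L) := List.ofFn (passEdge s t)

theorem length_pass (s t : Row L) : (pass s t).length = L := by simp [pass]

theorem passEdge_injective (s t : Row L) : Function.Injective (passEdge s t) := fun _ _ h =>
  congrArg (fun e : Edge L => e.1.2) h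

/-- A pass visits each level once, so an edge can occur only at its own level. -/
theorem count_pass (s t : Row L) (e : Edge L) :
    (pass s t).count e = if passEdge s t e.1.2 = e then 1 else 0 := by
  have hnd : (pass s t).Nodup := List.nodup_ofFn.2 (passEdge_injective s t)
  rw [hnd.count]
  congr 1
  rw [pass, List.mem_ofFn, eq_iff_iff]
  refine ⟨?_, fun h => ⟨_, h⟩⟩
  rintro ⟨i, rfl⟩
  rfl

theorem isWalk_of_getElem [NeZero L] (v : ℕ → Node L) (p : List (Edge L))
    (h : ∀ (k : ℕ) (hk : k < p.length), Edge.tail p[k] = v k ∧ Edge.head p[k] = v (k + 1)) :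
    IsWalk (v 0) p (v p.length) := by
  induction p generalizing v with
  | nil => rfl
  | cons e p ih =>
    have h0 := h 0 (by simp)
    refine ⟨h0.1, ?_⟩
    have h1 : Edge.head e = v 1 := h0.2
    rw [h1]
    exact ih (fun k => v (k + 1)) fun k hk => h (k + 1) (by simpa using hk)

theorem isWalk_pass [NeZero L] (s t : Row L) : IsWalk (terminal s) (pass s t) (terminal t) := by
  have h := isWalk_of_getElem (fun k => (passRow s t k, Fin.ofNat L k)) (pass s t) (by
    intro k hk
    rw [length_pass] at hk
    have hfin : Fin.ofNat L k = ⟨k, hk⟩ := Fin.ext (Nat.mod_eq_of_lt hk)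
    refine ⟨?_, ?_⟩
    · rw [hfin]
      simp [pass, passEdge, Edge.tail]
    · simp only [pass, List.getElem_ofFn, passEdge, Edge.head, Prod.mk.injEq]
      refine ⟨?_, ?_⟩
      · funext j
        have hj : j = ⟨k, hk⟩ ↔ (j : ℕ) = k := by rw [Fin.ext_iff]
        by_cases hjk : (j : ℕ) = k
        · obtain rfl := hj.2 hjk
          cases hs : s ⟨k, hk⟩ <;> cases ht : t ⟨k, hk⟩ <;> simp [passRow, hs, ht]
        · have hlt : (j : ℕ) < k + 1 ↔ (j : ℕ) < k := by omega
          split_ifs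
          · rw [Function.update_of_ne (fun h => hjk (hj.1 h))]
            simp [passRow, hlt]
          · simp [passRow, hlt]
      · ext
        simp [Fin.val_add, Fin.ofNat])
  have h0 : passRow s t 0 = s := by funext j; simp [passRow]
  have hL : passRow s t L = t := by funext j; simp [passRow]
  have hz : Fin.ofNat L 0 = 0 := rfl
  -- The level index wraps around, so step L lands on a terminal.
  have hzL : Fin.ofNat L L = 0 := Fin.ext (by simp [Fin.ofNat])
  simp only [length_pass, h0, hL, hz, hzL] at h
  exact h

/-- At most `2 ^ L` bit-fixing passes use a given edge. -/
theorem card_passEdge_eq_le (e : Edge L) :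
    #{p : Row L × Row L | passEdge p.1 p.2 e.1.2 = e} ≤ Fintype.card (Row L) := by
  rw [← Finset.card_univ]
  -- The edge fixes the sink's bits below its level and the source's bits from there on; the swapped
  -- row records exactly the remaining bits.
  apply Finset.card_le_card_of_injOn (fun p => passRow p.2 p.1 e.1.2) (by simp)
  intro p hp q hq hpq
  have hp' : passRow p.1 p.2 e.1.2 = passRow q.1 q.2 e.1.2 :=
    congrArg (fun f : Edge L => f.1.1)
      ((Finset.mem_filter.1 hp).2.trans (Finset.mem_filter.1 hq).2.symm)
  refine Prod.ext (funext fun j => ?_) (funext fun j => ?_)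
  all_goals
    have h1 := congrFun hp' j
    have h2 := congrFun hpq j
    simp only [passRow] at h1 h2
    split_ifs at h1 h2 <;> assumption

/-- The two-phase route along bit-fixing passes. -/
def passRoute [NeZero L] (s m t : Row L) : Route s t where
  mid := m
  phase₁ := pass s m
  phase₂ := pass m t
  length₁ := length_pass s m
  length₂ := length_pass m t
  walk₁ := isWalk_pass s m
  walk₂ := isWalk_pass m t

end Pass

/-! ### Selecting and routing pairs -/

section Selection

variable {L : ℕ}

/-- Half as many pairs as there are rows have pairwise distinct sources and destinations. -/
theorem Instance.exists_injOn [NeZero L] (I : Instance L) :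
    ∃ S : Finset (Fin (2 ^ L * L)), Set.InjOn I.src S ∧ Set.InjOn I.dst S ∧ 2 ^ L ≤ 2 * #S := by
  classical
  obtain ⟨S, hS, hmax⟩ := Finset.exists_max_image
    ({S | Set.InjOn I.src S ∧ Set.InjOn I.dst S} : Finset (Finset (Fin (2 ^ L * L))))
    Finset.card ⟨∅, by simp⟩
  obtain ⟨hs, ht⟩ := (Finset.mem_filter.1 hS).2
  refine ⟨S, hs, ht, ?_⟩
  -- By maximality every pair shares a source or a sink with a member of `S`, and each member
  -- accounts for at most 2L pairs.
  have hcover : (univ : Finset (Fin (2 ^ L * L))) ⊆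
      S.biUnion fun j => ({i | I.src i = I.src j} : Finset _) ∪
        ({i | I.dst i = I.dst j} : Finset _) := by
    intro i _
    by_contra hi
    simp only [Finset.mem_biUnion, Finset.mem_union, Finset.mem_filter, Finset.mem_univ,
      true_and, not_exists, not_and, not_or] at hi
    have hiS : i ∉ S := fun h => (hi i h).1 rfl
    have h1 := hmax (insert i S) (by
      simp only [Finset.mem_filter, Finset.mem_univ, true_and, Finset.coe_insert]
      rw [Set.injOn_insert (by simpa using hiS), Set.injOn_insert (by simpa using hiS)]
      refine ⟨⟨hs, ?_⟩, ht, ?_⟩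
      · rintro ⟨j, hj, hji⟩
        exact (hi j hj).1 hji.symm
      · rintro ⟨j, hj, hji⟩
        exact (hi j hj).2 hji.symm)
    rw [Finset.card_insert_of_notMem hiS] at h1
    omega
  have h1 := (Finset.card_le_card hcover).trans (Finset.card_biUnion_le_card_mul _ _ (2 * L) (by
    intro j _
    refine (Finset.card_union_le _ _).trans ?_
    rw [I.card_src, I.card_dst, two_mul]))
  rw [Finset.card_univ, Fintype.card_fin] at h1
  exact Nat.le_of_mul_le_mul_right (by linarith) (NeZero.pos L)

/-- Pairs with distinct sources and distinct destinations can be routed with small congestion,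
after discarding a small number of them. -/
theorem Instance.exists_routing [NeZero L] (I : Instance L) (S : Finset (Fin (2 ^ L * L)))
    (hs : Set.InjOn I.src S) (ht : Set.InjOn I.dst S) (y K : ℝ) (hy : 1 ≤ y) (hK : 0 ≤ K) :
    ∃ (S' : Finset (Fin (2 ^ L * L))) (P : Routing I S'),
      (#S : ℝ) - 4 * (2 ^ L * L) * Real.exp (2 * y) / y ^ K ≤ #S' ∧
      ∀ e : Edge L, (Routing.congestion P e : ℝ) ≤ 2 * K := by
  classical
  -- A resource is an edge together with a phase (`true` for the second), which gives 4 * 2 ^ L * L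
  -- resources.
  obtain ⟨R, hR⟩ : ∃ R : Edge L × Bool → Fin (2 ^ L * L) → Row L → Prop, ∀ e i m, R e i m ↔
      i ∈ S ∧ (if e.2 then passEdge m (I.dst i) else passEdge (I.src i) m) e.1.1.2 = e.1 :=
    ⟨_, fun _ _ _ => Iff.rfl⟩
  obtain ⟨r, hr⟩ := exists_choice_card_overloaded_le R y K hy (by
    rintro ⟨e, b⟩
    refine le_trans ?_ (card_passEdge_eq_le e)
    cases b
    · refine Finset.card_le_card_of_injOn (fun p => (I.src p.1, p.2)) ?_ ?_
      · intro p hp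
        rw [Finset.mem_coe, Finset.mem_filter, hR] at hp
        simpa using hp.2.2
      · intro p hp q hq hpq
        rw [Finset.mem_coe, Finset.mem_filter, hR] at hp hq
        simp only [Prod.mk.injEq] at hpq
        exact Prod.ext (hs hp.2.1 hq.2.1 hpq.1) hpq.2
    · refine Finset.card_le_card_of_injOn (fun p => (p.2, I.dst p.1)) ?_ ?_
      · intro p hp
        rw [Finset.mem_coe, Finset.mem_filter, hR] at hp
        simpa using hp.2.2
      · intro p hp q hq hpq
        rw [Finset.mem_coe, Finset.mem_filter, hR] at hp hq
        simp only [Prod.mk.injEq] at hpq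
        exact Prod.ext (ht hp.2.1 hq.2.1 hpq.2) hpq.1)
  set B : Finset (Fin (2 ^ L * L)) :=
    {a | ∃ e, R e a (r a) ∧ K < #{a' | R e a' (r a')}}
  refine ⟨S \ B, fun i => passRoute _ (r i) _, ?_, ?_⟩
  · have h1 : #S ≤ #(S \ B) + #B := by
      have := Finset.le_card_sdiff B S
      omega
    have h2 : (#S : ℝ) ≤ #(S \ B) + #B := by exact_mod_cast h1
    have h3 : (Fintype.card (Edge L × Bool) : ℝ) = 4 * (2 ^ L * L) := by
      simp; ring
    rw [h3] at hr
    replace hr : (#B : ℝ) ≤ 4 * (2 ^ L * L) * Real.exp (2 * y) / y ^ K := by convert hr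
    linarith
  · intro e
    have hload : ∀ b, (#{i ∈ S \ B | R (e, b) i (r i)} : ℝ) ≤ K := by
      intro b
      -- A single surviving user certifies that the resource was not overloaded even before the
      -- removal.
      rcases Finset.eq_empty_or_nonempty {i ∈ S \ B | R (e, b) i (r i)} with h | ⟨i, hi⟩
      · simpa [h] using hK
      · obtain ⟨hi, hRi⟩ := Finset.mem_filter.1 hi
        have hiB := (Finset.mem_sdiff.1 hi).2
        have h1 : ¬ K < #{a' | R (e, b) a' (r a')} := fun hlt =>
          hiB (Finset.mem_filter.2 ⟨Finset.mem_univ _, _, hRi, hlt⟩)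
        refine le_trans ?_ (not_lt.1 h1)
        exact_mod_cast Finset.card_le_card (Finset.filter_subset_filter _ (Finset.subset_univ _))
    have hcong : Routing.congestion (fun i : ↥(S \ B) => passRoute (I.src i) (r i) (I.dst i)) e =
        #{i ∈ S \ B | R (e, false) i (r i)} + #{i ∈ S \ B | R (e, true) i (r i)} := by
      unfold Routing.congestion
      rw [Finset.sum_coe_sort (S \ B)
        (fun i => (passRoute (I.src i) (r i) (I.dst i)).edges.count e)]
      rw [Finset.card_filter, Finset.card_filter, ← Finset.sum_add_distrib]
      refine Finset.sum_congr rfl fun i hi => ?_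
      have hiS := (Finset.mem_sdiff.1 hi).1
      simp [Route.edges, passRoute, count_pass, hR, hiS]
    rw [hcong]
    push_cast
    linarith [hload false, hload true]

end Selection

/-! ### Degrees and the bound on sources and sinks -/

section Degree

theorem card_tail_eq_le {L : ℕ} (v : Node L) : #{e : Edge L | Edge.tail e = v} ≤ 2 := by
  rw [← Fintype.card_bool, ← Finset.card_univ]
  refine Finset.card_le_card_of_injOn (fun e => e.2) (fun _ _ => by simp) fun e he f hf hef => ?_
  exact Prod.ext ((Finset.mem_filter.1 he).2.trans (Finset.mem_filter.1 hf).2.symm) hef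

variable {L : ℕ} [NeZero L]

theorem IsWalk.exists_mem_tail {u v : Node L} {p : List (Edge L)} (h : IsWalk u p v)
    (hp : p ≠ []) : ∃ e ∈ p, Edge.tail e = u := by
  cases p with
  | nil => exact absurd rfl hp
  | cons e p => exact ⟨e, by simp, h.1⟩

theorem IsWalk.exists_mem_head {u v : Node L} {p : List (Edge L)} (h : IsWalk u p v)
    (hp : p ≠ []) : ∃ e ∈ p, Edge.head e = v := by
  induction p generalizing u with
  | nil => exact absurd rfl hp
  | cons e p ih =>
    by_cases hp' : p = []
    · subst hp'
      exact ⟨e, by simp, h.2⟩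
    · obtain ⟨f, hf, hfv⟩ := ih h.2 hp'
      exact ⟨f, by simp [hf], hfv⟩

theorem card_head_eq_le (v : Node L) : #{e : Edge L | Edge.head e = v} ≤ 2 := by
  rw [← Fintype.card_bool, ← Finset.card_univ]
  refine Finset.card_le_card_of_injOn (fun e => e.2) (fun _ _ => by simp) fun e he f hf hef => ?_
  obtain ⟨⟨w, i⟩, b⟩ := e
  obtain ⟨⟨w', i'⟩, b'⟩ := f
  obtain rfl : b = b' := hef
  have h := (Finset.mem_filter.1 he).2.trans (Finset.mem_filter.1 hf).2.symm
  simp only [Edge.head, Prod.mk.injEq] at h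
  obtain rfl : i = i' := add_right_cancel h.2
  have hw : w = w' := by
    cases b
    · simpa using h.1
    · funext j
      have hj := congrFun h.1 j
      by_cases hji : j = i
      · subst hji
        simpa using hj
      · simpa [Function.update_of_ne hji] using hj
  rw [hw]

/-- The number of routes that use an edge of `T` is at most the total congestion of `T`. -/
theorem Routing.card_le_mul_congestion {I : Instance L} {S : Finset (Fin (2 ^ L * L))}
    (P : Routing I S) (M : ℝ) (hM : ∀ e, (Routing.congestion P e : ℝ) ≤ M)
    (T : Finset (Edge L)) (A : Finset (Fin (2 ^ L * L))) (hA : A ⊆ S)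
    (hT : ∀ i : S, (i : Fin (2 ^ L * L)) ∈ A → ∃ e ∈ T, e ∈ (P i).edges) : (#A : ℝ) ≤ #T * M := by
  classical
  have h1 : #A ≤ ∑ e ∈ T, Routing.congestion P e := by
    unfold Routing.congestion
    rw [Finset.sum_comm]
    calc #A = ∑ i ∈ S, if i ∈ A then 1 else 0 := by
          rw [← Finset.card_filter, Finset.filter_mem_eq_inter, Finset.inter_eq_right.2 hA]
      _ = ∑ i : S, if (i : Fin (2 ^ L * L)) ∈ A then 1 else 0 :=
          (Finset.sum_coe_sort S fun i => if i ∈ A then 1 else 0).symm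
      _ ≤ _ := by
          refine Finset.sum_le_sum fun i _ => ?_
          split_ifs with hi
          · obtain ⟨e, he, hei⟩ := hT i hi
            exact (List.count_pos_iff.2 hei).trans_le
              (Finset.single_le_sum (f := fun e => (P i).edges.count e)
                (fun _ _ => Nat.zero_le _) he)
          · exact Nat.zero_le _
  calc (#A : ℝ) ≤ ∑ e ∈ T, (Routing.congestion P e : ℝ) := by exact_mod_cast h1
    _ ≤ ∑ _e ∈ T, M := Finset.sum_le_sum fun e _ => hM e
    _ = _ := by simp

/-- No row is the source or the destination of more than four times as many routed pairs as the
largest congestion. -/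
theorem Routing.card_src_or_dst_le {I : Instance L} {S : Finset (Fin (2 ^ L * L))}
    (P : Routing I S) (M : ℝ) (hM : ∀ e, (Routing.congestion P e : ℝ) ≤ M) (w : Row L) :
    (#{i ∈ S | I.src i = w ∨ I.dst i = w} : ℝ) ≤ 4 * M := by
  classical
  have hM0 : 0 ≤ M := (Nat.cast_nonneg _).trans (hM ((w, 0), false))
  have hne : ∀ p : List (Edge L), p.length = L → p ≠ [] := by
    rintro p hp rfl
    exact NeZero.ne L hp.symm
  have h1 : (#{i ∈ S | I.src i = w} : ℝ) ≤ 2 * M := by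
    refine (Routing.card_le_mul_congestion P M hM {e | Edge.tail e = terminal w} _
      (Finset.filter_subset _ _) ?_).trans ?_
    · intro i hi
      obtain ⟨e, he, hw⟩ := (P i).walk₁.exists_mem_tail (hne _ (P i).length₁)
      rw [(Finset.mem_filter.1 hi).2] at hw
      exact ⟨e, by simp [hw], List.mem_append_left _ he⟩
    · gcongr
      exact_mod_cast card_tail_eq_le (terminal w)
  have h2 : (#{i ∈ S | I.dst i = w} : ℝ) ≤ 2 * M := by
    refine (Routing.card_le_mul_congestion P M hM {e | Edge.head e = terminal w} _
      (Finset.filter_subset _ _) ?_).trans ?_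
    · intro i hi
      obtain ⟨e, he, hw⟩ := (P i).walk₂.exists_mem_head (hne _ (P i).length₂)
      rw [(Finset.mem_filter.1 hi).2] at hw
      exact ⟨e, by simp [hw], List.mem_append_right _ he⟩
    · gcongr
      exact_mod_cast card_head_eq_le (terminal w)
  rw [Finset.filter_or]
  have h3 : (#({i ∈ S | I.src i = w} ∪ {i ∈ S | I.dst i = w}) : ℝ) ≤
      #{i ∈ S | I.src i = w} + #{i ∈ S | I.dst i = w} := by
    exact_mod_cast Finset.card_union_le _ _
  linarith

end Degree

end ButterflyRouting

/-! ### Choice of constants -/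

open ButterflyRouting in
theorem mainTheorem7 :
    ∃ c C D : ℝ, ∃ N : ℕ, 0 < c ∧ 0 < C ∧ 0 < D ∧
      ∀ (n L : ℕ) [NeZero L], n = 2 ^ L → N ≤ n → ∀ I : Instance L,
        (∃ (S : Finset (Fin (2 ^ L * L))) (P : Routing I S),
          c * (n : ℝ) ≤ (S.card : ℝ) ∧
          ∀ e : Edge L, (Routing.congestion P e : ℝ) ≤
            C * (Real.log (Real.log n) / Real.log (Real.log (Real.log n)))) ∧
        (∀ (S : Finset (Fin (2 ^ L * L))) (P : Routing I S),
          (∀ e : Edge L, (Routing.congestion P e : ℝ) ≤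
            C * (Real.log (Real.log n) / Real.log (Real.log (Real.log n)))) →
          ∀ w : Row L,
            ((S.filter fun i => I.src i = w ∨ I.dst i = w).card : ℝ) ≤
              D * Real.log (Real.log n)) := by
  have hlim : Filter.Tendsto (fun n : ℕ => Real.log (Real.log n)) Filter.atTop Filter.atTop :=
    Real.tendsto_log_atTop.comp (Real.tendsto_log_atTop.comp tendsto_natCast_atTop_atTop)
  obtain ⟨N, hN⟩ := Filter.eventually_atTop.1 (hlim.eventually_ge_atTop 4)
  -- 1/4 is 1/2 minus the loss of 1/4; 8 is two phases times the 4 in K; 32 is 4 * 8. The bound x ≥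
  -- 4 yields log x ≥ 1 and exp x ≥ 32.
  refine ⟨1 / 4, 8, 32, N, by norm_num, by norm_num, by norm_num, ?_⟩
  intro n L _ hn hNn I
  have hx := hN n hNn
  set x := Real.log (Real.log n) with hxdef
  have hL : (1 : ℝ) ≤ L := by exact_mod_cast NeZero.pos L
  have hlogn : Real.log n = L * Real.log 2 := by
    rw [hn]; push_cast; rw [← Real.rpow_natCast, Real.log_rpow (by norm_num)]
  have hexp : Real.exp x = L * Real.log 2 := by
    have := Real.log_two_gt_d9
    rw [hxdef, hlogn, Real.exp_log (by positivity)]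
  have hLx : (L : ℝ) ≤ 2 * Real.exp x := by
    have := Real.log_two_gt_d9
    rw [hexp]; nlinarith
  have hlogx : 1 ≤ Real.log x := by
    rw [Real.le_log_iff_exp_le (by linarith)]
    linarith [Real.exp_one_lt_d9]
  constructor
  · obtain ⟨S, hs, ht, hS⟩ := I.exists_injOn
    obtain ⟨S', P, hS', hP⟩ := I.exists_routing S hs ht x (4 * (x / Real.log x)) (by linarith)
      (by positivity)
    refine ⟨S', P, ?_, fun e => (hP e).trans_eq (by ring)⟩
    have hpow : x ^ (4 * (x / Real.log x)) = Real.exp (4 * x) := by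
      rw [Real.rpow_def_of_pos (by linarith)]
      congr 1
      field_simp
    have hS2 : (n : ℝ) ≤ 2 * S.card := by rw [hn]; exact_mod_cast hS
    have hn2 : (2 : ℝ) ^ L = n := by rw [hn]; push_cast; rfl
    rw [hpow, hn2] at hS'
    have hE : (32 : ℝ) ≤ Real.exp x := by
      have h1 : (2.7 : ℝ) ≤ Real.exp 1 := by linarith [Real.exp_one_gt_d9]
      have h2 : Real.exp 1 ^ 4 ≤ Real.exp x := by
        rw [← Real.exp_nat_mul]
        exact Real.exp_le_exp.2 (by push_cast; linarith)
      have h3 : (2.7 : ℝ) ^ 4 ≤ Real.exp 1 ^ 4 := by gcongr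
      have h4 : (32 : ℝ) ≤ 2.7 ^ 4 := by norm_num
      linarith
    -- As L ≤ 2 exp x, the loss is at most 8n exp (-x).
    have hloss : 4 * ((n : ℝ) * L) * Real.exp (2 * x) / Real.exp (4 * x) ≤ n / 4 := by
      have h2 : Real.exp (2 * x) = Real.exp x ^ 2 := by rw [← Real.exp_nat_mul]; norm_num
      have h4 : Real.exp (4 * x) = Real.exp x ^ 4 := by rw [← Real.exp_nat_mul]; norm_num
      rw [h2, h4, div_le_iff₀ (by positivity)]
      calc 4 * ((n : ℝ) * L) * Real.exp x ^ 2
          ≤ 4 * (n * (2 * Real.exp x)) * Real.exp x ^ 2 := by gcongr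
        _ = n / 4 * (32 * Real.exp x ^ 3) := by ring
        _ ≤ n / 4 * (Real.exp x * Real.exp x ^ 3) := by gcongr
        _ = _ := by ring
    linarith
  · intro S P hP w
    refine (Routing.card_src_or_dst_le P _ hP w).trans ?_
    have : x / Real.log x ≤ x := div_le_self (by linarith) hlogx
    linarith
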